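/- Let $\Sigma$ be a (possibly non-reduced) abstract root system in a finite-dimensional real inner product space $V$: a finite set of non-zero vectors spanning $V$ such that $A_{\alpha,\beta}=2\langle\alpha,\beta\rangle/|\alpha|^2\in\mathbb{Z}$ and $\beta-A_{\alpha,\beta}\,\alpha\in\Sigma$ for all $\alpha,\beta\in\Sigma$. Let $\Sigma^+$ be the set of positive roots, namely those lying on a fixed side of a hyperplane that contains no root, and let $\Pi$ be the set of simple roots, namely the positive roots that are not the sum of two positive roots; $\Pi$ is a basis of $V$. The level of $\sum_{\alpha\in\Pi}n_\alpha\alpha$ is $\sum_{\alpha\in\Pi}n_\alpha$. For $\Phi\subseteq\Pi$ and $\lambda\in\Sigma$, the $\Phi$-string of $\lambda$ is the set $I_\Phi^\lambda$ of all elements of $\Sigma\cup\{0\}$ of the form $\lambda+\sum_{\alpha\in\Phi}n_\alpha\alpha$ with $n_\alpha\in\mathbb{Z}$; it is trivial if $I_\Phi^\lambda=\{\lambda\}$. The root $\lambda$ is of minimum level in its $\Phi$-string if no element of $I_\Phi^\lambda$ has smaller level. A set $\Phi\subseteq\Pi$ is connected if it is not the union of two non-empty subsets that are orthogonal to each other.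 Let $\Phi_1,\dots,\Phi_n$, $n\ge 1$, be connected and mutually orthogonal subsets of $\Pi$ such that $\Phi=\Phi_1\cup\dots\cup\Phi_n$ is a proper subset of $\Pi$. Let $\lambda\in\Sigma^+$ be a positive root not in $\operatorname{span}_{\mathbb{Z}}\Phi$, and let $I\subseteq\{1,\dots,n\}$ be the set of those $k$ for which the $\Phi_k$-string of $\lambda$ is not trivial. (i) If $\lambda$ is of minimum level in its $\Phi$-string, then for each $k\in I$ there exists a unique root $\alpha_k\in\Phi_k$ such that $A_{\alpha_k,\lambda}<0$ and $A_{\beta,\lambda}=0$ for every $\beta\in\Phi_k\setminus\{\alpha_k\}$. (ii) Conversely, suppose that $|\alpha|\ge|\nu|$ for all $k\in I$, all $\alpha\in\Phi_k$ and all $\nu\in I_\Phi^\lambda$. If for each $k\in I$ there exists $\alpha_k\in\Phi_k$ such that $A_{\alpha_k,\lambda}<0$ and $A_{\beta,\lambda}=0$ for every $\beta\in\Phi_k\setminus\{\alpha_k\}$, then $\lambda$ is of minimum level in its $\Phi$-string. -/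

import Mathlib

namespace PhiString

noncomputable section

variable {V : Type*} [NormedAddCommGroup V] [InnerProductSpace ℝ V]

/-- The Cartan number `A_{α,β} = 2⟨α,β⟩ / |α|²`. -/
def cartan (α β : V) : ℝ := 2 * inner ℝ α β / ‖α‖ ^ 2

/-- `S` is a (possibly non-reduced, possibly reducible) abstract root system in the real inner
product space `V`. -/
structure IsRootSystem (S : Set V) : Prop where
  finite : S.Finite
  ne_zero : ∀ α ∈ S, α ≠ 0
  span_eq_top : Submodule.span ℝ S = ⊤
  cartan_int : ∀ α ∈ S, ∀ β ∈ S, ∃ m : ℤ, cartan α β = m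
  reflect_mem : ∀ α ∈ S, ∀ β ∈ S, β - cartan α β • α ∈ S

/-- The hyperplane `f = 0` contains no root, so that `0 < f` is a positivity criterion on `S`. -/
def IsRegular (S : Set V) (f : Module.Dual ℝ V) : Prop := ∀ α ∈ S, f α ≠ 0

/-- The positive roots: those on the side `0 < f` of the hyperplane `f = 0`. -/
def posRoots (S : Set V) (f : Module.Dual ℝ V) : Set V := {α ∈ S | 0 < f α}

/-- The simple roots: the positive roots that are not the sum of two positive roots. -/
def simpleRoots (S : Set V) (f : Module.Dual ℝ V) : Set V :=
  {α ∈ posRoots S f | ∀ β ∈ posRoots S f, ∀ γ ∈ posRoots S f, α ≠ β + γ}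

/-- The `Φ`-string of `v`: all elements of `S ∪ {0}` of the form `v + ∑_{α ∈ Φ} n_α α` with
integers `n_α`. -/
def string (S Φ : Set V) (v : V) : Set V :=
  {μ ∈ S ∪ {0} | μ - v ∈ Submodule.span ℤ Φ}

/-- The positive roots that are not spanned by `Φ`. -/
def posRootsOff (S : Set V) (f : Module.Dual ℝ V) (Φ : Set V) : Set V :=
  posRoots S f \ (Submodule.span ℤ Φ : Set V)

/-- All elements of `Φ` are orthogonal to all elements of `Ψ`. -/
def AreOrthogonal (Φ Ψ : Set V) : Prop := ∀ α ∈ Φ, ∀ β ∈ Ψ, inner ℝ α β = 0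

/-- `Φ` is not a union of two non-empty subsets that are orthogonal to each other. -/
def IsConnectedSet (Φ : Set V) : Prop :=
  ∀ Φ₁ Φ₂ : Set V, Φ = Φ₁ ∪ Φ₂ → Φ₁.Nonempty → Φ₂.Nonempty → ¬ AreOrthogonal Φ₁ Φ₂

section Level

variable {S : Set V} {f : Module.Dual ℝ V}

theorem IsRootSystem.neg_mem (hS : IsRootSystem S) {α : V} (hα : α ∈ S) : -α ∈ S := by
  have h := hS.reflect_mem α hα α hα
  have h2 : cartan α α = 2 := by
    have : ‖α‖ ≠ 0 := norm_ne_zero_iff.mpr (hS.ne_zero α hα)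
    unfold cartan
    rw [real_inner_self_eq_norm_sq]
    field_simp
  rw [h2, two_smul] at h
  simpa using h

theorem IsRootSystem.sub_mem (hS : IsRootSystem S) {α β : V} (hα : α ∈ S) (hβ : β ∈ S)
    (hne : α ≠ β) (hpos : 0 < inner ℝ α β) : α - β ∈ S := by
  have ha : 0 < ‖α‖ ^ 2 := pow_pos (norm_pos_iff.mpr (hS.ne_zero α hα)) 2
  have hb : 0 < ‖β‖ ^ 2 := pow_pos (norm_pos_iff.mpr (hS.ne_zero β hβ)) 2
  obtain ⟨m, hm⟩ := hS.cartan_int α hα β hβ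
  obtain ⟨k, hk⟩ := hS.cartan_int β hβ α hα
  have h1 := hS.reflect_mem α hα β hβ
  have h2 := hS.reflect_mem β hβ α hα
  rw [hm] at h1
  rw [hk] at h2
  unfold cartan at hm hk
  rw [real_inner_comm] at hk
  have hm0 : 0 < m := by
    have : (0 : ℝ) < m := hm ▸ by positivity
    exact_mod_cast this
  have hk0 : 0 < k := by
    have : (0 : ℝ) < k := hk ▸ by positivity
    exact_mod_cast this
  by_cases hm1 : m = 1
  · subst hm1
    simpa using hS.neg_mem h1
  by_cases hk1 : k = 1
  · subst hk1
    simpa using h2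
  exfalso
  have hm2 : (2 : ℝ) ≤ m := by exact_mod_cast (by omega : 2 ≤ m)
  have hk2 : (2 : ℝ) ≤ k := by exact_mod_cast (by omega : 2 ≤ k)
  rw [← hm, le_div_iff₀ ha] at hm2
  rw [← hk, le_div_iff₀ hb] at hk2
  have h := norm_sub_sq_real α β
  have h0 : ‖α - β‖ ^ 2 ≤ 0 := by linarith
  have : ‖α - β‖ = 0 := by nlinarith [norm_nonneg (α - β)]
  exact hne (sub_eq_zero.mp (norm_eq_zero.mp this))

theorem inner_simple_nonpos (hS : IsRootSystem S) (hf : IsRegular S f) {α β : V}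
    (hα : α ∈ simpleRoots S f) (hβ : β ∈ simpleRoots S f) (hne : α ≠ β) :
    inner ℝ α β ≤ 0 := by
  by_contra! hpos
  have h := hS.sub_mem hα.1.1 hβ.1.1 hne hpos
  rcases lt_or_gt_of_ne (hf _ h) with h0 | h0
  · have h' : β - α ∈ posRoots S f := by
      refine ⟨by simpa using hS.neg_mem h, ?_⟩
      rw [map_sub] at h0 ⊢
      linarith
    exact hβ.2 α hα.1 _ h' (by abel)
  · exact hα.2 β hβ.1 _ ⟨h, h0⟩ (by abel)

theorem linearIndependent_simple (hS : IsRootSystem S) (hf : IsRegular S f) :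
    LinearIndependent ℝ (Subtype.val : simpleRoots S f → V) := by
  refine LinearMap.BilinForm.linearIndependent_of_pairwise_le_zero (innerₗ V) ?_ f _
    (fun i => i.2.1.2) ?_
  · intro v hv
    have : 0 < ‖v‖ := norm_pos_iff.mpr hv
    simpa [real_inner_self_eq_norm_sq] using pow_pos this 2
  · intro i j hij
    simpa using inner_simple_nonpos hS hf i.2 j.2 (fun h => hij (Subtype.ext h))

/-- Each positive root is a combination of simple roots with non-negative integer coefficients. -/
theorem posRoots_subset_closure (hS : IsRootSystem S) :
    posRoots S f ⊆ AddSubmonoid.closure (simpleRoots S f) := by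
  by_contra hbad
  have hfin : (posRoots S f \ AddSubmonoid.closure (simpleRoots S f)).Finite :=
    hS.finite.subset fun x hx => hx.1.1
  obtain ⟨α, ⟨hα, hα'⟩, hmin⟩ :=
    Set.exists_min_image _ f hfin (Set.sdiff_nonempty.mpr hbad)
  have hns : α ∉ simpleRoots S f := fun h => hα' (AddSubmonoid.subset_closure h)
  simp only [simpleRoots, Set.mem_ofPred_eq, not_and, not_forall, not_not] at hns
  obtain ⟨β, hβ, γ, hγ, rfl⟩ := hns hα
  have key : ∀ δ ∈ posRoots S f, f δ < f (β + γ) →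
      δ ∈ AddSubmonoid.closure (simpleRoots S f) := by
    intro δ hδ hlt
    by_contra h
    exact absurd (hmin δ ⟨hδ, h⟩) (not_le.mpr hlt)
  refine hα' (add_mem (key β hβ ?_) (key γ hγ ?_))
  · simpa using hγ.2
  · simpa using hβ.2

theorem span_simple (hS : IsRootSystem S) (hf : IsRegular S f) :
    ⊤ ≤ Submodule.span ℝ (Set.range (Subtype.val : simpleRoots S f → V)) := by
  rw [Subtype.range_coe, ← hS.span_eq_top, Submodule.span_le]
  have hpos : ∀ α ∈ posRoots S f, α ∈ Submodule.span ℝ (simpleRoots S f) := fun α hα =>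
    (AddSubmonoid.closure_le (S := (Submodule.span ℝ (simpleRoots S f)).toAddSubmonoid)).mpr
      Submodule.subset_span (posRoots_subset_closure hS hα)
  intro α hα
  rcases lt_or_gt_of_ne (hf α hα) with h | h
  · have := hpos (-α) ⟨hS.neg_mem hα, by simpa using h⟩
    simpa using neg_mem this
  · exact hpos α ⟨hα, h⟩

/-- The simple roots form a basis of `V`. -/
def simpleBasis (hS : IsRootSystem S) (hf : IsRegular S f) :
    Module.Basis (simpleRoots S f) ℝ V :=
  Module.Basis.mk (linearIndependent_simple hS hf) (span_simple hS hf)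

/-- The level of `v = ∑_{α simple} n_α α`, that is, `∑_{α simple} n_α`. -/
def level (hS : IsRootSystem S) (hf : IsRegular S f) (v : V) : ℝ :=
  (simpleBasis hS hf).sumCoords v

/-- `v` has the minimum level among the elements of its `Φ`-string. -/
def IsMinLevel (hS : IsRootSystem S) (hf : IsRegular S f) (Φ : Set V) (v : V) : Prop :=
  ∀ μ ∈ string S Φ v, level hS hf v ≤ level hS hf μ

end Level

end

end PhiString

/-!
Both parts rest on two facts about the `Φ`-string of a root `v` outside `span_ℤ Φ`.

The string is connected: for `μ ≠ μ'` in it, write `μ' - μ` as a sum of elements of `Φ ∪ -Φ`. Since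
`0 < ⟨μ' - μ, μ' - μ⟩`, some summand `α` has `0 < ⟨μ', α⟩` or `⟨μ, α⟩ < 0`, so that `μ' - α` or
`μ + α` is a root and the distance can be shortened (`string_subset_of_closed`).

A root `v` such that no `v - α`, `α ∈ Φ`, is a root generates its string by adding simple roots only
(`string_subset_reachable`), hence has minimum level. The point is that the set of roots reached in
this way is closed under subtraction of elements of `Φ`, which follows from a statement on four roots
of sum zero (`IsRootSystem.add_mem_of_four`), a combinatorial substitute for the Jacobi identity.

For (i), minimality of the level gives `⟨v, α⟩ ≤ 0` for `α ∈ Φ`. If `v` were orthogonal to `Φ k`, then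
reflections and minimality would rule out all of `v ± α`, so the `Φ k`-string would be trivial by
connectedness. If two elements of `Φ k` had negative product with `v`, then `Φ k ∪ {v}` would have a
cycle in its Dynkin diagram: the sum of the normalised elements of the connected set `Φ k` has norm at
most one (`norm_sum_normalize_le_one`), and adding the unit vector of `v` would give zero, whereas the
positivity functional is positive on it.

For (ii), if `v - α` were a root, then `|v - α| ≤ |α|` and `⟨v, α⟩ ≤ 0` would give `|v|² ≤ 0`;
for `k ∉ I` the `Φ k`-string is trivial anyway. So `v - α` is never a root, and the second fact applies.
-/

namespace PhiString

variable {V : Type*} [NormedAddCommGroup V] [InnerProductSpace ℝ V]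
variable {S : Set V} {f : Module.Dual ℝ V}

/-! ### Sums and strings of roots -/

theorem cartan_neg_iff {α β : V} (hα : α ≠ 0) : cartan α β < 0 ↔ inner ℝ α β < 0 := by
  have ha : 0 < ‖α‖ ^ 2 := pow_pos (norm_pos_iff.mpr hα) 2
  rw [cartan, div_lt_iff₀ ha, zero_mul]
  constructor <;> intro h <;> linarith

theorem cartan_eq_zero_iff {α β : V} (hα : α ≠ 0) : cartan α β = 0 ↔ inner ℝ α β = 0 := by
  have ha : ‖α‖ ^ 2 ≠ 0 := (pow_pos (norm_pos_iff.mpr hα) 2).ne'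
  simp [cartan, ha]

theorem IsRootSystem.add_mem (hS : IsRootSystem S) {α β : V} (hα : α ∈ S) (hβ : β ∈ S)
    (hne : α + β ≠ 0) (hneg : inner ℝ α β < 0) : α + β ∈ S := by
  have h := hS.sub_mem hα (hS.neg_mem hβ) (fun h => hne (by rw [h]; simp))
    (by rw [inner_neg_right]; linarith)
  simpa using h

/-- If all four products were non-negative, then `0 ≤ ⟨a + b, c + d⟩ = -|a + b|²`. -/
theorem IsRootSystem.add_mem_of_four (hS : IsRootSystem S) {a b c d : V} (ha : a ∈ S)
    (hb : b ∈ S) (hc : c ∈ S) (hd : d ∈ S) (hsum : a + b + c + d = 0) (hab : a + b ≠ 0)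
    (hac : a + c ≠ 0) (had : a + d ≠ 0) : a + c ∈ S ∨ a + d ∈ S := by
  have hbd : b + d = -(a + c) := by
    rw [eq_neg_iff_add_eq_zero, ← hsum]; abel
  have hbc : b + c = -(a + d) := by
    rw [eq_neg_iff_add_eq_zero, ← hsum]; abel
  have hcd : c + d = -(a + b) := by
    rw [eq_neg_iff_add_eq_zero, ← hsum]; abel
  by_contra! h
  have h1 : 0 ≤ inner ℝ a c := by
    by_contra! hn
    exact h.1 (hS.add_mem ha hc hac hn)
  have h2 : 0 ≤ inner ℝ a d := by
    by_contra! hn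
    exact h.2 (hS.add_mem ha hd had hn)
  have h3 : 0 ≤ inner ℝ b d := by
    by_contra! hn
    have := hS.neg_mem (hS.add_mem hb hd (by rw [hbd]; exact neg_ne_zero.mpr hac) hn)
    rw [hbd, neg_neg] at this
    exact h.1 this
  have h4 : 0 ≤ inner ℝ b c := by
    by_contra! hn
    have := hS.neg_mem (hS.add_mem hb hc (by rw [hbc]; exact neg_ne_zero.mpr had) hn)
    rw [hbc, neg_neg] at this
    exact h.2 this
  have h5 : inner ℝ (a + b) (c + d) = -‖a + b‖ ^ 2 := by
    rw [hcd, inner_neg_right, real_inner_self_eq_norm_sq]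
  have h6 : inner ℝ (a + b) (c + d)
      = inner ℝ a c + inner ℝ a d + (inner ℝ b c + inner ℝ b d) := by
    rw [inner_add_left, inner_add_right, inner_add_right]
  have h7 : 0 < ‖a + b‖ ^ 2 := pow_pos (norm_pos_iff.mpr hab) 2
  linarith

/-- A sum of a multiset of vectors with positive product with `w` has a summand with positive
product with `w`. -/
theorem exists_mem_inner_pos_of_inner_sum_pos (w : V) (s : Multiset V)
    (h : 0 < inner ℝ w s.sum) : ∃ a ∈ s, 0 < inner ℝ w a := by
  induction s using Multiset.induction_on with
  | empty => simp at h
  | cons a s ih =>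
    rw [Multiset.sum_cons, inner_add_right] at h
    by_cases ha : 0 < inner ℝ w a
    · exact ⟨a, Multiset.mem_cons_self a s, ha⟩
    · obtain ⟨b, hb, hb'⟩ := ih (by linarith)
      exact ⟨b, Multiset.mem_cons_of_mem hb, hb'⟩

theorem exists_multiset_of_mem_span_int {W : Type*} [AddCommGroup W] {Ψ : Set W} {x : W} (hx : x ∈ Submodule.span ℤ Ψ) :
    ∃ s : Multiset W, (∀ a ∈ s, a ∈ Ψ ∨ -a ∈ Ψ) ∧ s.sum = x := by
  rw [← Submodule.mem_toAddSubgroup, Submodule.span_int_eq_addSubgroupClosure,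
    ← AddSubgroup.mem_toAddSubmonoid, AddSubgroup.closure_toAddSubmonoid] at hx
  obtain ⟨s, hs, hsum⟩ := AddSubmonoid.exists_multiset_of_mem_closure hx
  exact ⟨s, fun a ha => by simpa using hs a ha, hsum⟩

/-- Strings are connected: a set containing `v` and stable under the addition and the subtraction of
elements of `Ψ`, as long as the result is a root, contains the `Ψ`-string of `v`. -/
theorem string_subset_of_closed (hS : IsRootSystem S) {Ψ : Set V} (hΨ : Ψ ⊆ S) {v : V}
    (hvS : v ∈ S) (hoff : v ∉ Submodule.span ℤ Ψ) {G : Set V} (hvG : v ∈ G)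
    (hadd : ∀ μ ∈ G, ∀ α ∈ Ψ, μ + α ∈ S → μ + α ∈ G)
    (hsub : ∀ μ ∈ G, ∀ α ∈ Ψ, μ - α ∈ S → μ - α ∈ G) : string S Ψ v ⊆ G := by
  have hstep : ∀ μ ∈ G, ∀ a, (a ∈ Ψ ∨ -a ∈ Ψ) → μ + a ∈ S → μ + a ∈ G := by
    rintro μ hμ a (ha | ha) h
    · exact hadd μ hμ a ha h
    · simpa using hsub μ hμ _ ha (by simpa using h)
  have hspan : ∀ a, (a ∈ Ψ ∨ -a ∈ Ψ) → a ∈ Submodule.span ℤ Ψ := by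
    rintro a (ha | ha)
    · exact Submodule.subset_span ha
    · simpa using neg_mem (Submodule.subset_span (R := ℤ) ha)
  have hroot : ∀ a, (a ∈ Ψ ∨ -a ∈ Ψ) → a ∈ S := by
    rintro a (ha | ha)
    · exact hΨ ha
    · simpa using hS.neg_mem (hΨ ha)
  -- Induction on the number of steps, moving either end point towards the other one.
  have key : ∀ (N : ℕ) (s : Multiset V), Multiset.card s = N → (∀ a ∈ s, a ∈ Ψ ∨ -a ∈ Ψ) →
      ∀ μ ∈ G, μ ∈ S → μ ∉ Submodule.span ℤ Ψ → μ + s.sum ∈ S → μ + s.sum ∈ G := by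
    intro N
    induction N with
    | zero =>
      intro s hs _ μ hμ _ _ _
      rw [Multiset.card_eq_zero] at hs
      simpa [hs] using hμ
    | succ N ih =>
      intro s hcard hs μ hμ hμS hμoff hsS
      by_cases h0 : s.sum = 0
      · simpa [h0] using hμ
      have hpos : 0 < inner ℝ s.sum s.sum := real_inner_self_pos.mpr h0
      obtain ⟨a, has, ha⟩ := exists_mem_inner_pos_of_inner_sum_pos _ _ hpos
      obtain ⟨t, rfl⟩ := Multiset.exists_cons_of_mem has
      have ht : ∀ b ∈ t, b ∈ Ψ ∨ -b ∈ Ψ := fun b hb => hs b (Multiset.mem_cons_of_mem hb)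
      have htc : Multiset.card t = N := by simpa using hcard
      have htspan : t.sum ∈ Submodule.span ℤ Ψ :=
        multiset_sum_mem _ fun b hb => hspan b (ht b hb)
      have haΨ := hs a has
      rw [Multiset.sum_cons] at ha hsS ⊢
      by_cases hμa : inner ℝ μ a < 0
      · have hne : μ + a ≠ 0 := fun h => hμoff (by
          rw [eq_neg_of_add_eq_zero_left h]; exact neg_mem (hspan a haΨ))
        have h1 := hS.add_mem hμS (hroot a haΨ) hne hμa
        have h2 := ih t htc ht (μ + a) (hstep μ hμ a haΨ h1) h1
          (fun h => hμoff (by simpa using sub_mem h (hspan a haΨ)))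
        rw [← add_assoc] at hsS ⊢
        exact h2 hsS
      · have h3 : 0 < inner ℝ (μ + (a + t.sum)) a := by
          rw [inner_add_left]; linarith
        have hne : μ + (a + t.sum) ≠ a := fun h => hμoff (by
          have : μ = -t.sum := by
            rw [eq_neg_iff_add_eq_zero]
            have h' : μ + t.sum + a = a := by rw [add_assoc, add_comm t.sum, h]
            simpa using h'
          rw [this]; exact neg_mem htspan)
        have h1 := hS.sub_mem hsS (hroot a haΨ) hne h3
        have e : μ + (a + t.sum) - a = μ + t.sum := by abel
        rw [e] at h1
        have h2 := ih t htc ht μ hμ hμS hμoff h1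
        have e' : μ + (a + t.sum) = μ + t.sum + a := by abel
        rw [e'] at hsS ⊢
        exact hstep _ h2 a haΨ hsS
  rintro μ ⟨hμ, hμv⟩
  have hμoff : μ ∉ Submodule.span ℤ Ψ := fun h => hoff (by simpa using sub_mem h hμv)
  have hμS : μ ∈ S := by
    rcases hμ with h | h
    · exact h
    · exact absurd (by rw [Set.mem_singleton_iff.mp h]; exact zero_mem _) hμoff
  obtain ⟨s, hs, hsum⟩ := exists_multiset_of_mem_span_int hμv
  have e : v + s.sum = μ := by rw [hsum]; abel
  have := key _ s rfl hs v hvG hvS hoff (by rw [e]; exact hμS)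
  rwa [e] at this

/-! ### Locally lowest roots -/

/-- The vectors obtained from `v` by successively adding elements of `Φ` such that each sum is in
`S`. -/
inductive Reachable (S Φ : Set V) (v : V) : V → Prop
  | base : Reachable S Φ v v
  | step (μ α : V) : Reachable S Φ v μ → α ∈ Φ → μ + α ∈ S → Reachable S Φ v (μ + α)

theorem Reachable.mem {W : Type*} [NormedAddCommGroup W] {S Φ : Set W} {v μ : W}
    (h : Reachable S Φ v μ) (hv : v ∈ S) : μ ∈ S := by
  cases h with
  | base => exact hv
  | step μ α _ _ h => exact h

theorem Reachable.sub_mem_span {W : Type*} [NormedAddCommGroup W] {S Φ : Set W} {v μ : W}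
    (h : Reachable S Φ v μ) :
    μ - v ∈ Submodule.span ℤ Φ := by
  induction h with
  | base => simp
  | step μ α _ hα _ ih =>
    rw [add_sub_right_comm]
    exact add_mem ih (Submodule.subset_span hα)

theorem sub_notMem_of_simple (hS : IsRootSystem S) (hf : IsRegular S f) {α β : V}
    (hα : α ∈ simpleRoots S f) (hβ : β ∈ simpleRoots S f) : α - β ∉ S := by
  intro h
  rcases lt_or_gt_of_ne (hf _ h) with h0 | h0
  · refine hβ.2 α hα.1 (β - α) ⟨by simpa using hS.neg_mem h, ?_⟩ (by abel)
    rw [map_sub] at h0 ⊢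
    linarith
  · exact hα.2 β hβ.1 _ ⟨h, h0⟩ (by abel)

/-- The roots reached from a locally lowest root `v` are stable under subtraction of `α ∈ Φ`: if
`μ + β - α` is a root with simple `β ≠ α`, then so is `μ - α`, because `β - α` is not a root. -/
theorem Reachable.sub_simple (hS : IsRootSystem S) (hf : IsRegular S f) {Φ : Set V}
    (hΦ : Φ ⊆ simpleRoots S f) {v : V} (hv : v ∈ S) (hoff : v ∉ Submodule.span ℤ Φ)
    (hlow : ∀ α ∈ Φ, v - α ∉ S) {μ : V} (h : Reachable S Φ v μ) :
    ∀ α ∈ Φ, μ - α ∈ S → Reachable S Φ v (μ - α) := by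
  induction h with
  | base => exact fun α hα h => absurd h (hlow α hα)
  | step μ β hμ hβ hμβ ih =>
    intro α hα hroot
    by_cases hne : β = α
    · subst hne
      simpa using hμ
    have hμoff : μ ∉ Submodule.span ℤ Φ := fun h =>
      hoff (by simpa using sub_mem h hμ.sub_mem_span)
    have key := hS.add_mem_of_four (hμ.mem hv) (hΦ hβ).1.1 (hS.neg_mem (hΦ hα).1.1)
      (hS.neg_mem hroot) (by abel) (hS.ne_zero _ hμβ)
      (fun h => hμoff (by
        rw [eq_neg_of_add_eq_zero_left h, neg_neg]; exact Submodule.subset_span hα))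
      (fun h => hne (by
        have e : μ + -(μ + β - α) = α - β := by abel
        rw [e] at h
        exact (sub_eq_zero.mp h).symm))
    have e : μ + -(μ + β - α) = α - β := by abel
    rw [e, ← sub_eq_add_neg] at key
    have h1 : μ - α ∈ S := key.resolve_right (sub_notMem_of_simple hS hf (hΦ hα) (hΦ hβ))
    have e' : μ + β - α = μ - α + β := by abel
    rw [e'] at hroot ⊢
    exact Reachable.step _ _ (ih α hα h1) hβ hroot

theorem string_subset_reachable (hS : IsRootSystem S) (hf : IsRegular S f) {Φ : Set V}
    (hΦ : Φ ⊆ simpleRoots S f) {v : V} (hv : v ∈ S) (hoff : v ∉ Submodule.span ℤ Φ)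
    (hlow : ∀ α ∈ Φ, v - α ∉ S) : string S Φ v ⊆ {μ | Reachable S Φ v μ} :=
  string_subset_of_closed hS (fun _ hα => (hΦ hα).1.1) hv hoff Reachable.base
    (fun _ hμ α hα h => Reachable.step _ α hμ hα h)
    (fun _ hμ α hα h => hμ.sub_simple hS hf hΦ hv hoff hlow α hα h)

theorem level_simple (hS : IsRootSystem S) (hf : IsRegular S f) {α : V}
    (hα : α ∈ simpleRoots S f) : level hS hf α = 1 := by
  have h : simpleBasis hS hf ⟨α, hα⟩ = α := by simp [simpleBasis]
  rw [level, ← h, Module.Basis.sumCoords_self_apply]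

theorem Reachable.level_le (hS : IsRootSystem S) (hf : IsRegular S f) {Φ : Set V}
    (hΦ : Φ ⊆ simpleRoots S f) {v μ : V} (h : Reachable S Φ v μ) :
    level hS hf v ≤ level hS hf μ := by
  induction h with
  | base => exact le_rfl
  | step μ α _ hα _ ih =>
    have h1 : level hS hf (μ + α) = level hS hf μ + 1 := by
      rw [← level_simple hS hf (hΦ hα)]
      exact map_add _ _ _
    linarith

theorem isMinLevel_of_sub_notMem (hS : IsRootSystem S) (hf : IsRegular S f) {Φ : Set V}
    (hΦ : Φ ⊆ simpleRoots S f) {v : V} (hv : v ∈ S) (hoff : v ∉ Submodule.span ℤ Φ)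
    (hlow : ∀ α ∈ Φ, v - α ∉ S) : IsMinLevel hS hf Φ v := fun _ hμ =>
  (string_subset_reachable hS hf hΦ hv hoff hlow hμ).level_le hS hf hΦ

theorem IsMinLevel.sub_notMem {hS : IsRootSystem S} {hf : IsRegular S f} {Φ : Set V}
    (hΦ : Φ ⊆ simpleRoots S f) {v : V} (hmin : IsMinLevel hS hf Φ v) {α : V} (hα : α ∈ Φ) :
    v - α ∉ S := by
  intro h
  have h1 := hmin (v - α) ⟨Or.inl h, by
    simpa using neg_mem (Submodule.subset_span (R := ℤ) hα)⟩
  have h2 : level hS hf (v - α) = level hS hf v - 1 := by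
    rw [← level_simple hS hf (hΦ hα)]
    exact map_sub _ _ _
  linarith

/-! ### Connected sets of simple roots -/

/-- The unit vectors of two roots at an obtuse angle have product at most `-1/2`, because the two
Cartan numbers are negative integers, so that their product is at least one. -/
theorem IsRootSystem.two_mul_inner_normalize_le (hS : IsRootSystem S) {α β : V} (hα : α ∈ S)
    (hβ : β ∈ S) (hneg : inner ℝ α β < 0) :
    2 * inner ℝ (‖α‖⁻¹ • α) (‖β‖⁻¹ • β) ≤ -1 := by
  have ha : 0 < ‖α‖ := norm_pos_iff.mpr (hS.ne_zero α hα)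
  have hb : 0 < ‖β‖ := norm_pos_iff.mpr (hS.ne_zero β hβ)
  obtain ⟨m, hm⟩ := hS.cartan_int α hα β hβ
  obtain ⟨k, hk⟩ := hS.cartan_int β hβ α hα
  have hm0 : (m : ℝ) < 0 := hm ▸ (cartan_neg_iff (hS.ne_zero α hα)).mpr hneg
  have hk0 : (k : ℝ) < 0 :=
    hk ▸ (cartan_neg_iff (hS.ne_zero β hβ)).mpr (by rwa [real_inner_comm])
  have hm1 : (m : ℝ) ≤ -1 := by
    have : m < 0 := by exact_mod_cast hm0
    exact_mod_cast (by omega : m ≤ -1)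
  have hk1 : (k : ℝ) ≤ -1 := by
    have : k < 0 := by exact_mod_cast hk0
    exact_mod_cast (by omega : k ≤ -1)
  rw [← hm, cartan, div_le_iff₀ (pow_pos ha 2)] at hm1
  rw [← hk, cartan, div_le_iff₀ (pow_pos hb 2), real_inner_comm] at hk1
  have h1 : 2 * inner ℝ α β ≤ -(‖α‖ * ‖β‖) := by
    rcases le_total ‖α‖ ‖β‖ with h | h
    · nlinarith
    · nlinarith
  rw [real_inner_smul_left, real_inner_smul_right]
  have h2 : 2 * (‖α‖⁻¹ * (‖β‖⁻¹ * inner ℝ α β)) = (2 * inner ℝ α β) / (‖α‖ * ‖β‖) := by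
    field_simp
  rw [h2, div_le_iff₀ (mul_pos ha hb)]
  linarith

theorem norm_normalize_sq {α : V} (hα : α ≠ 0) : ‖‖α‖⁻¹ • α‖ ^ 2 = 1 := by
  rw [norm_smul, norm_inv, norm_norm, inv_mul_cancel₀ (norm_ne_zero_iff.mpr hα), one_pow]

theorem inner_normalize_nonpos {α β : V} (h : inner ℝ α β ≤ 0) :
    inner ℝ (‖α‖⁻¹ • α) (‖β‖⁻¹ • β) ≤ 0 := by
  rw [real_inner_smul_left, real_inner_smul_right, ← mul_assoc]
  exact mul_nonpos_of_nonneg_of_nonpos (by positivity) h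

/-- A largest subset satisfying the bound is everything: otherwise, by connectedness, an element of
the complement is not orthogonal to it and can be added without violating the bound. -/
theorem norm_sum_normalize_le_one (hS : IsRootSystem S) (T : Finset V) (hT : ↑T ⊆ S)
    (hneg : ∀ α ∈ T, ∀ β ∈ T, α ≠ β → inner ℝ α β ≤ 0) (hconn : IsConnectedSet (T : Set V)) :
    ‖∑ α ∈ T, ‖α‖⁻¹ • α‖ ^ 2 ≤ 1 := by
  classical
  rcases T.eq_empty_or_nonempty with rfl | ⟨a₀, ha₀⟩
  · simp
  set e : V → V := fun α => ‖α‖⁻¹ • α with he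
  let P : Finset (Finset V) := {U ∈ T.powerset | U.Nonempty ∧ ‖∑ α ∈ U, e α‖ ^ 2 ≤ 1}
  have hP : P.Nonempty := ⟨{a₀}, by
    simp only [P, Finset.mem_filter, Finset.mem_powerset, Finset.singleton_subset_iff,
      Finset.singleton_nonempty, Finset.sum_singleton, true_and]
    exact ⟨ha₀, (norm_normalize_sq (hS.ne_zero _ (hT ha₀))).le⟩⟩
  obtain ⟨U, hU, hmax⟩ := P.exists_max_image Finset.card hP
  simp only [P, Finset.mem_filter, Finset.mem_powerset] at hU hmax
  obtain ⟨hUT, hUne, hUle⟩ := hU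
  by_cases hUeq : U = T
  · rwa [hUeq] at hUle
  exfalso
  have hcompl : (T \ U).Nonempty := by
    rw [Finset.sdiff_nonempty]
    exact fun h => hUeq (hUT.antisymm h)
  have hno := hconn U (T \ U : Finset V)
    (by rw [← Finset.coe_union, Finset.union_sdiff_of_subset hUT])
    (by simpa using hUne) (by exact_mod_cast hcompl)
  simp only [AreOrthogonal, not_forall] at hno
  obtain ⟨a, ha, b, hb, hab⟩ := hno
  have ha' : a ∈ U := by simpa using ha
  have hb' : b ∈ T ∧ b ∉ U := by simpa using hb
  have hne : ∀ c ∈ U, c ≠ b := fun c hc h => hb'.2 (h ▸ hc)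
  have hlt : inner ℝ a b < 0 :=
    lt_of_le_of_ne (hneg a (hUT ha') b hb'.1 (hne a ha')) hab
  have hin : 2 * inner ℝ (∑ α ∈ U, e α) (e b) ≤ -1 := by
    rw [← Finset.add_sum_erase U e ha', inner_add_left, sum_inner]
    have h1 := hS.two_mul_inner_normalize_le (hT (hUT ha')) (hT hb'.1) hlt
    have h2 : ∑ c ∈ U.erase a, inner ℝ (e c) (e b) ≤ 0 :=
      Finset.sum_nonpos fun c hc => inner_normalize_nonpos
        (hneg c (hUT (Finset.mem_of_mem_erase hc)) b hb'.1 (hne c (Finset.mem_of_mem_erase hc)))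
    simp only [he] at h2 ⊢
    linarith
  have hnew : ‖∑ α ∈ insert b U, e α‖ ^ 2 ≤ 1 := by
    rw [Finset.sum_insert hb'.2, add_comm, norm_add_sq_real]
    have h3 : ‖e b‖ ^ 2 = 1 := norm_normalize_sq (hS.ne_zero _ (hT hb'.1))
    linarith
  have := hmax (insert b U)
    ⟨Finset.insert_subset hb'.1 hUT, Finset.insert_nonempty _ _, hnew⟩
  rw [Finset.card_insert_of_notMem hb'.2] at this
  omega

/-- The Dynkin diagram has no cycle through `v` and a connected set of simple roots. -/
theorem eq_of_inner_neg_of_connected (hS : IsRootSystem S) (hf : IsRegular S f) {Ψ : Set V}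
    (hΨ : Ψ ⊆ simpleRoots S f) (hconn : IsConnectedSet Ψ) {v : V} (hv : v ∈ posRoots S f)
    (hle : ∀ α ∈ Ψ, inner ℝ α v ≤ 0) {α β : V} (hα : α ∈ Ψ) (hβ : β ∈ Ψ)
    (hαv : inner ℝ α v < 0) (hβv : inner ℝ β v < 0) : α = β := by
  classical
  by_contra hne
  have hfin : Ψ.Finite := hS.finite.subset fun x hx => (hΨ hx).1.1
  lift Ψ to Finset V using hfin
  simp only [Finset.mem_coe] at hα hβ hle
  have hΨS : (Ψ : Set V) ⊆ S := fun x hx => (hΨ hx).1.1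
  have h1 := norm_sum_normalize_le_one hS Ψ hΨS
    (fun a ha b hb hab => inner_simple_nonpos hS hf (hΨ ha) (hΨ hb) hab) hconn
  have h2 : 2 * inner ℝ (∑ c ∈ Ψ, ‖c‖⁻¹ • c) (‖v‖⁻¹ • v) ≤ -2 := by
    have hβ' : β ∈ Ψ.erase α := Finset.mem_erase.mpr ⟨Ne.symm hne, hβ⟩
    rw [← Finset.add_sum_erase Ψ _ hα, ← Finset.add_sum_erase _ _ hβ', inner_add_left,
      inner_add_left, sum_inner]
    have h3 := hS.two_mul_inner_normalize_le (hΨS hα) hv.1 hαv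
    have h4 := hS.two_mul_inner_normalize_le (hΨS hβ) hv.1 hβv
    have h5 : ∑ c ∈ (Ψ.erase α).erase β, inner ℝ (‖c‖⁻¹ • c) (‖v‖⁻¹ • v) ≤ 0 :=
      Finset.sum_nonpos fun c hc => inner_normalize_nonpos
        (hle c (Finset.mem_of_mem_erase (Finset.mem_of_mem_erase hc)))
    linarith
  have h6 : ‖(∑ c ∈ Ψ, ‖c‖⁻¹ • c) + ‖v‖⁻¹ • v‖ ^ 2 ≤ 0 := by
    rw [norm_add_sq_real, norm_normalize_sq (hS.ne_zero _ hv.1)]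
    linarith
  have h7 : (∑ c ∈ Ψ, ‖c‖⁻¹ • c) + ‖v‖⁻¹ • v = 0 :=
    norm_eq_zero.mp (pow_eq_zero_iff two_ne_zero |>.mp (le_antisymm h6 (by positivity)))
  have h8 : 0 < f ((∑ c ∈ Ψ, ‖c‖⁻¹ • c) + ‖v‖⁻¹ • v) := by
    rw [map_add, map_sum, map_smul, smul_eq_mul]
    refine add_pos_of_nonneg_of_pos (Finset.sum_nonneg fun c hc => ?_)
      (mul_pos (inv_pos.mpr (norm_pos_iff.mpr (hS.ne_zero _ hv.1))) hv.2)
    rw [map_smul, smul_eq_mul]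
    exact mul_nonneg (by positivity) (hΨ hc).1.2.le
  rw [h7, map_zero] at h8
  exact lt_irrefl _ h8

/-! ### Minimum level and Cartan numbers -/

/-- If the string of `v` is non-trivial and no `v - α` is a root, then some `v + α` is one, and by
reflection `α` is not orthogonal to `v`. -/
theorem exists_inner_ne_zero_of_string_ne (hS : IsRootSystem S) {Ψ : Set V} (hΨ : Ψ ⊆ S) {v : V}
    (hv : v ∈ S) (hoff : v ∉ Submodule.span ℤ Ψ) (hlow : ∀ α ∈ Ψ, v - α ∉ S)
    (hne : string S Ψ v ≠ {v}) : ∃ α ∈ Ψ, inner ℝ α v ≠ 0 := by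
  by_contra! h0
  refine hne (Set.Subset.antisymm (string_subset_of_closed hS hΨ hv hoff rfl ?_ ?_) ?_)
  · rintro μ rfl α hα h
    have h1 := hS.reflect_mem α (hΨ hα) _ h
    have hα0 : α ≠ 0 := hS.ne_zero α (hΨ hα)
    have h2 : cartan α (μ + α) = 2 := by
      have : ‖α‖ ≠ 0 := norm_ne_zero_iff.mpr hα0
      rw [cartan, inner_add_right, h0 α hα, real_inner_self_eq_norm_sq]
      field_simp
      ring
    rw [h2, two_smul] at h1
    exact absurd (by simpa using h1) (hlow α hα)
  · rintro μ rfl α hα h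
    exact absurd h (hlow α hα)
  · rintro μ rfl
    exact ⟨Or.inl hv, by simp⟩

/-- If `v - α` is no longer than `α`, then `|v|² = |v - α|² - |α|² + 2⟨v, α⟩ ≤ 0`. -/
theorem sub_notMem_of_norm_le {v α : V} (hv : v ≠ 0) (hle : inner ℝ α v ≤ 0)
    (hnorm : v - α ∈ S → ‖v - α‖ ≤ ‖α‖) : v - α ∉ S := by
  intro h
  have h1 := hnorm h
  have h2 := norm_add_sq_real (v - α) α
  rw [sub_add_cancel, inner_sub_left, real_inner_self_eq_norm_sq, real_inner_comm] at h2
  have h3 : 0 < ‖v‖ ^ 2 := pow_pos (norm_pos_iff.mpr hv) 2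
  have h4 : ‖v - α‖ ^ 2 ≤ ‖α‖ ^ 2 := pow_le_pow_left₀ (norm_nonneg _) h1 2
  linarith

end PhiString

theorem mainTheorem5 {V : Type*} [NormedAddCommGroup V] [InnerProductSpace ℝ V]
    [FiniteDimensional ℝ V] (S : Set V) (hS : PhiString.IsRootSystem S)
    (f : Module.Dual ℝ V) (hf : PhiString.IsRegular S f)
    (n : ℕ) (hn : 1 ≤ n) (Φ : Fin n → Set V)
    (hconn : ∀ k, PhiString.IsConnectedSet (Φ k))
    (horth : ∀ k l, k ≠ l → PhiString.AreOrthogonal (Φ k) (Φ l))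
    (hproper : (⋃ k, Φ k) ⊂ PhiString.simpleRoots S f)
    (v : V) (hv : v ∈ PhiString.posRootsOff S f (⋃ k, Φ k))
    (I : Set (Fin n)) (hI : ∀ k, k ∈ I ↔ PhiString.string S (Φ k) v ≠ {v}) :
    (PhiString.IsMinLevel hS hf (⋃ k, Φ k) v →
      ∀ k ∈ I, ∃! α, α ∈ Φ k ∧ PhiString.cartan α v < 0 ∧
        ∀ β ∈ Φ k, β ≠ α → PhiString.cartan β v = 0) ∧
    ((∀ k ∈ I, ∀ α ∈ Φ k, ∀ ν ∈ PhiString.string S (⋃ j, Φ j) v, ‖ν‖ ≤ ‖α‖) →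
      (∀ k ∈ I, ∃ α ∈ Φ k, PhiString.cartan α v < 0 ∧
        ∀ β ∈ Φ k, β ≠ α → PhiString.cartan β v = 0) →
      PhiString.IsMinLevel hS hf (⋃ k, Φ k) v) := by
  open PhiString in
  have hsub : ∀ k, Φ k ⊆ ⋃ j, Φ j := fun k => Set.subset_iUnion Φ k
  have hsimple : ∀ k, Φ k ⊆ simpleRoots S f := fun k => (hsub k).trans hproper.1
  have hvS : v ∈ S := hv.1.1
  have hne0 : ∀ k, ∀ α ∈ Φ k, α ≠ 0 := fun k α hα => hS.ne_zero α (hsimple k hα).1.1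
  have hoff : ∀ k, v ∉ Submodule.span ℤ (Φ k) := fun k h =>
    hv.2 (Submodule.span_mono (hsub k) h)
  constructor
  · intro hmin k hk
    have hlow : ∀ α ∈ Φ k, v - α ∉ S := fun α hα =>
      hmin.sub_notMem hproper.1 (hsub k hα)
    have hle : ∀ α ∈ Φ k, inner ℝ α v ≤ 0 := by
      intro α hα
      by_contra! hpos
      refine hlow α hα (hS.sub_mem hvS (hsimple k hα).1.1 ?_ (by rwa [real_inner_comm]))
      rintro rfl
      exact hoff k (Submodule.subset_span hα)
    obtain ⟨α, hα, hαv⟩ := exists_inner_ne_zero_of_string_ne hS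
      (fun _ h => (hsimple k h).1.1) hvS (hoff k) hlow ((hI k).mp hk)
    have hαneg : inner ℝ α v < 0 := lt_of_le_of_ne (hle α hα) hαv
    have huniq : ∀ β ∈ Φ k, inner ℝ β v < 0 → β = α := fun β hβ hβv =>
      eq_of_inner_neg_of_connected hS hf (hsimple k) (hconn k) hv.1 hle hβ hα hβv hαneg
    refine ⟨α, ⟨hα, (cartan_neg_iff (hne0 k α hα)).mpr hαneg, fun β hβ hne => ?_⟩, ?_⟩
    · rw [cartan_eq_zero_iff (hne0 k β hβ)]
      by_contra h
      exact hne (huniq β hβ (lt_of_le_of_ne (hle β hβ) h))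
    · rintro β ⟨hβ, hβv, -⟩
      exact huniq β hβ ((cartan_neg_iff (hne0 k β hβ)).mp hβv)
  · intro hnorm hex
    refine isMinLevel_of_sub_notMem hS hf hproper.1 hvS hv.2 fun α hα => ?_
    obtain ⟨k, hαk⟩ := Set.mem_iUnion.mp hα
    by_cases hk : k ∈ I
    · refine sub_notMem_of_norm_le (hS.ne_zero v hvS) ?_ fun h => ?_
      · obtain ⟨γ, hγ, hγv, hγ0⟩ := hex k hk
        by_cases hαγ : α = γ
        · rw [hαγ]
          exact ((cartan_neg_iff (hne0 k γ hγ)).mp hγv).le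
        · exact ((cartan_eq_zero_iff (hne0 k α hαk)).mp (hγ0 α hαk hαγ)).le
      · exact hnorm k hk α hαk (v - α) ⟨Or.inl h, by
          simpa using neg_mem (Submodule.subset_span (R := ℤ) hα)⟩
    · -- The `Φ k`-string of `v` is trivial, so it does not contain `v - α ≠ v`.
      intro h
      have htriv : string S (Φ k) v = {v} := by
        by_contra h'
        exact hk ((hI k).mpr h')
      have hmem : v - α ∈ string S (Φ k) v := ⟨Or.inl h, by
        simpa using neg_mem (Submodule.subset_span (R := ℤ) hαk)⟩
      rw [htriv, Set.mem_singleton_iff, sub_eq_self] at hmem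
      exact hne0 k α hαk hmem
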